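/- **Notation.** For real matrices let $\|\cdot\|_F,\|\cdot\|,\|\cdot\|_*,\|\cdot\|_{\max},\|\cdot\|_1,\|\cdot\|_0$ denote the Frobenius norm, spectral norm, nuclear norm, entrywise $\ell_\infty$-norm, entrywise $\ell_1$-norm and number of nonzero entries, and let $\|U\|_{2,\infty}$ be the largest Euclidean norm of a row of $U$. Let $\mathcal O_{p,r}^{\mu}$ be the set of $U\in\mathbb R^{p\times r}$ with $U^\top U=I_r$ and $\|U\|_{2,\infty}\le\sqrt{\mu r/p}$. For a parameter $\lambda\ge 0$ put $\Phi(\Delta)=\inf_{L+S=\Delta}\{\|L\|_*+\lambda\|S\|_1\}$ for $\Delta\in\mathbb R^{p\times p}$. **Theorem.** There is an absolute constant $c>0$ such that the following holds for every $p$, every linear map $\mathfrak X$ from $\mathbb R^{p\times p}$ to a Euclidean space $E$ with conjugate operator $\mathfrak X^\star$ (with respect to the trace inner product on matrices), and every $W\in E$ (no assumption is made on the noise $W$). Let $Y=\mathfrak X(L^\star+S^\star)+W$ with $L^\star,S^\star\in\mathbb R^{p\times p}$, and let $r\le\bar r$, $\mu\le\bar\mu$, $\bar s\in\mathbb N$.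 Assume: 1. (restricted strong convexity) $\frac12\|\mathfrak X(\Delta)\|^2\ge\frac\kappa2\|\Delta\|_F^2-\tau\,\Phi^2(\Delta)$ for all $\Delta\in\mathbb R^{p\times p}$, where $\kappa>0$ and $\tau\in\mathbb R$; 2. $\kappa\ge 32\,\tau\,\bar s\max(1,\lambda^2)$ and $\kappa\ge 32\,\tau\,\bar r$ (the second condition follows from the first if $\tau\le0$ or $\bar r\le\bar s$); 3. $L^\star=U^\star\Sigma^\star V^{\star\top}$ is a singular value decomposition with $U^\star,V^\star\in\mathcal O_{p,r}^{\mu}$ and $\Sigma^\star$ diagonal and nonnegative; $\|S^\star\|_0\le\bar s$ and $8c\,\bar\mu\,\bar r^4\,\bar s\le p$; and, in case $r<\bar r$, also $\bar\mu\ge p/(p-\bar r+1)$. Let $(\widehat L,\widehat S,\widehat U,\widehat V,\widehat\Sigma)$ be any global solution of $$\min_{L,S,U,V,\Sigma}\ \tfrac12\|Y-\mathfrak X(L+S)\|^2\quad\text{subject to}\quad L=U\Sigma V^\top,\ \ U,V\in\mathcal O_{p,\bar r}^{\bar\mu},\ \ \Sigma\in\mathbb R^{\bar r\times\bar r}\text{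 diagonal},\ \ \|S\|_0\le\bar s .$$ Then $$\|\widehat L-L^\star\|_F^2+\|\widehat S-S^\star\|_F^2\ \le\ \frac{128}{\kappa^2}\Big(\bar r\,\|\mathfrak X^\star(W)\|^2+\bar s\,\|\mathfrak X^\star(W)\|_{\max}^2\Big).$$ -/

import Mathlib

open scoped Matrix

noncomputable section

namespace LowRankSparse

variable {m n p q r : ℕ}

/-- Frobenius norm. -/
def frobNorm (A : Matrix (Fin m) (Fin n) ℝ) : ℝ :=
  Real.sqrt (∑ i, ∑ j, A i j ^ 2)

/-- Spectral norm: the operator norm of `A` acting on Euclidean space. -/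
def specNorm (A : Matrix (Fin p) (Fin p) ℝ) : ℝ :=
  ‖Matrix.toEuclideanCLM (n := Fin p) (𝕜 := ℝ) A‖

/-- Largest absolute value of an entry. -/
def maxNorm (A : Matrix (Fin m) (Fin n) ℝ) : ℝ :=
  ⨆ ij : Fin m × Fin n, |A ij.1 ij.2|

/-- Entrywise `ℓ₁` norm. -/
def l1Norm (A : Matrix (Fin m) (Fin n) ℝ) : ℝ :=
  ∑ i, ∑ j, |A i j|

/-- Number of nonzero entries. -/
def l0Norm (A : Matrix (Fin m) (Fin n) ℝ) : ℕ :=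
  {ij : Fin m × Fin n | A ij.1 ij.2 ≠ 0}.ncard

/-- Nuclear norm: the sum of all singular values (with multiplicity). -/
def nuclearNorm (A : Matrix (Fin p) (Fin p) ℝ) : ℝ :=
  ∑ i ∈ Finset.range p, (Matrix.toEuclideanLin A).singularValues i

/-- `‖U‖_{2,∞}`: the largest Euclidean norm of a row. -/
def twoInfNorm (U : Matrix (Fin m) (Fin n) ℝ) : ℝ :=
  ⨆ i : Fin m, Real.sqrt (∑ j, U i j ^ 2)

/-- The set `𝒪_{p,r}^μ` of `p × r` matrices with orthonormal columns that are `μ`-incoherent. -/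
def IncoherentFrames (p r : ℕ) (μ : ℝ) : Set (Matrix (Fin p) (Fin r) ℝ) :=
  {U | Uᵀ * U = 1 ∧ twoInfNorm U ≤ Real.sqrt (μ * r / p)}

/-- `L` is `μ`-incoherent of rank (at most) `r`: it has a singular value decomposition
`L = U Σ Vᵀ`, with `Σ` diagonal and nonnegative, and `U, V ∈ 𝒪_{p,r}^μ`. -/
def HasIncoherentSVD (L : Matrix (Fin p) (Fin p) ℝ) (r : ℕ) (μ : ℝ) : Prop :=
  ∃ U ∈ IncoherentFrames p r μ, ∃ V ∈ IncoherentFrames p r μ, ∃ σ : Fin r → ℝ,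
    (∀ k, 0 ≤ σ k) ∧ L = U * Matrix.diagonal σ * Vᵀ

/-- The regularizer `Φ(Δ) = inf { ‖L‖_* + λ ‖S‖₁ : L + S = Δ }`. -/
def regularizer (lam : ℝ) (Δ : Matrix (Fin p) (Fin p) ℝ) : ℝ :=
  sInf {x | ∃ L S : Matrix (Fin p) (Fin p) ℝ, L + S = Δ ∧ x = nuclearNorm L + lam * l1Norm S}

section Observation

variable {E : Type*} [NormedAddCommGroup E] [InnerProductSpace ℝ E]

/-- Restricted strong convexity of the observation map with parameters `(κ, τ)`. -/
def RSC (X : Matrix (Fin p) (Fin p) ℝ →ₗ[ℝ] E) (lam κ τ : ℝ) : Prop :=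
  ∀ Δ : Matrix (Fin p) (Fin p) ℝ,
    1 / 2 * ‖X Δ‖ ^ 2 ≥ κ / 2 * frobNorm Δ ^ 2 - τ * regularizer lam Δ ^ 2

/-- The conjugate operator `𝔛*` of `𝔛`, for the trace inner product on matrices, given by its
entries `⟨E_{ij}, 𝔛*(w)⟩ = ⟨𝔛(E_{ij}), w⟩`. -/
def conjOp (X : Matrix (Fin p) (Fin p) ℝ →ₗ[ℝ] E) (w : E) : Matrix (Fin p) (Fin p) ℝ :=
  Matrix.of fun i j => inner ℝ (X (Matrix.single i j 1)) w

/-- The defining property of the conjugate operator, `⟨𝔛(Δ), w⟩ = Tr(Δ 𝔛*(w)ᵀ)`. -/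
theorem inner_eq_trace_conjOp (X : Matrix (Fin p) (Fin p) ℝ →ₗ[ℝ] E)
    (Δ : Matrix (Fin p) (Fin p) ℝ) (w : E) :
    inner ℝ (X Δ) w = (Δ * (conjOp X w)ᵀ).trace := by
  conv_lhs => rw [Matrix.matrix_eq_sum_single Δ]
  simp only [map_sum, sum_inner, Matrix.trace, Matrix.diag_apply, Matrix.mul_apply,
    Matrix.transpose_apply, conjOp, Matrix.of_apply]
  refine Finset.sum_congr rfl fun i _ => Finset.sum_congr rfl fun j _ => ?_
  have h : Matrix.single i j (Δ i j) = Δ i j • Matrix.single i j (1 : ℝ) := by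
    simp [Matrix.smul_single]
  rw [h, map_smul, real_inner_smul_left]

/-- The constraints of the least-squares program: `L = U Σ Vᵀ` with `Σ` diagonal,
`U, V ∈ 𝒪_{p,r}^μ` and `‖S‖₀ ≤ s`. -/
def Feasible (r s : ℕ) (μ : ℝ) (L S : Matrix (Fin p) (Fin p) ℝ)
    (U V : Matrix (Fin p) (Fin r) ℝ) (σ : Fin r → ℝ) : Prop :=
  L = U * Matrix.diagonal σ * Vᵀ ∧ U ∈ IncoherentFrames p r μ ∧ V ∈ IncoherentFrames p r μ ∧
    l0Norm S ≤ s

/-- `(L, S, U, V, Σ)` is a (global) solution of the incoherence-constrained least-squares program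
`min ½ ‖Y - 𝔛(L + S)‖²`. -/
def IsSolution (X : Matrix (Fin p) (Fin p) ℝ →ₗ[ℝ] E) (Y : E) (r s : ℕ) (μ : ℝ)
    (L S : Matrix (Fin p) (Fin p) ℝ) (U V : Matrix (Fin p) (Fin r) ℝ) (σ : Fin r → ℝ) : Prop :=
  Feasible r s μ L S U V σ ∧
    ∀ (L' S' : Matrix (Fin p) (Fin p) ℝ) (U' V' : Matrix (Fin p) (Fin r) ℝ) (σ' : Fin r → ℝ),
      Feasible r s μ L' S' U' V' σ' →
        1 / 2 * ‖Y - X (L + S)‖ ^ 2 ≤ 1 / 2 * ‖Y - X (L' + S')‖ ^ 2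

end Observation

end LowRankSparse

end

namespace LowRankSparse

variable {m n p r : ℕ}

/-! ### Frobenius norm and trace inner product. -/

section Frobenius

/-! Write D and S for the low-rank and sparse errors. If the truth is feasible, optimality gives
½‖𝔛(D+S)‖² ≤ ⟨𝔛(D+S), W⟩ (`half_norm_sq_le_inner`). Restricted strong convexity bounds the left side
below by κ/2 ‖D+S‖² minus the regularizer term, which is small because D has rank at most 2r̄ and S
at most 2s̄ nonzeros (`mul_regularizer_sq_le`).

The crux is separating D from S. Projecting onto the column space of one frame splits D into
orthogonal pieces (`exists_orthogonal_splitting`), so incoherence bounds every entry of D by a small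
multiple of ‖D‖ itself, whatever the singular values (`abs_sub_entry_le`). A sparse S is then nearly
orthogonal to D (`frobNorm_add_sq_ge`). The same splitting bounds the noise term.

If r < r̄, feasibility of the truth needs r̄-column incoherent frames; these come from adjoining
flat unit vectors (`exists_flat_unit_vector`). -/

lemma frobNorm_nonneg (A : Matrix (Fin m) (Fin n) ℝ) : 0 ≤ frobNorm A :=
  Real.sqrt_nonneg _

lemma frobNorm_sq (A : Matrix (Fin m) (Fin n) ℝ) : frobNorm A ^ 2 = ∑ i, ∑ j, A i j ^ 2 :=
  Real.sq_sqrt (Finset.sum_nonneg fun _ _ => Finset.sum_nonneg fun _ _ => sq_nonneg _)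

lemma frobNorm_sq_eq_trace (A : Matrix (Fin m) (Fin n) ℝ) :
    frobNorm A ^ 2 = (Aᵀ * A).trace := by
  rw [frobNorm_sq, Finset.sum_comm]
  simp [Matrix.trace, Matrix.mul_apply, sq]

lemma trace_mul_transpose (A B : Matrix (Fin m) (Fin n) ℝ) :
    (A * Bᵀ).trace = ∑ i, ∑ j, A i j * B i j := by
  simp [Matrix.trace, Matrix.mul_apply]

lemma trace_mul_transpose_le (A B : Matrix (Fin m) (Fin n) ℝ) :
    (A * Bᵀ).trace ≤ frobNorm A * frobNorm B := by
  rw [trace_mul_transpose]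
  have h := Finset.sum_mul_sq_le_sq_mul_sq (Finset.univ : Finset (Fin m × Fin n))
    (fun x => A x.1 x.2) (fun x => B x.1 x.2)
  simp only [Fintype.sum_prod_type, ← frobNorm_sq, ← mul_pow] at h
  exact (abs_le_of_sq_le_sq' h (mul_nonneg (frobNorm_nonneg _) (frobNorm_nonneg _))).2

lemma frobNorm_add_sq (A B : Matrix (Fin m) (Fin n) ℝ) :
    frobNorm (A + B) ^ 2 = frobNorm A ^ 2 + 2 * (A * Bᵀ).trace + frobNorm B ^ 2 := by
  simp only [frobNorm_sq, trace_mul_transpose, Finset.mul_sum, ← Finset.sum_add_distrib]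
  refine Finset.sum_congr rfl fun i _ => Finset.sum_congr rfl fun j _ => ?_
  simp only [Matrix.add_apply]
  ring

lemma sum_row_sq_le (A : Matrix (Fin m) (Fin n) ℝ) (i : Fin m) :
    ∑ j, A i j ^ 2 ≤ frobNorm A ^ 2 := by
  rw [frobNorm_sq]
  exact Finset.single_le_sum (f := fun i => ∑ j, A i j ^ 2)
    (fun _ _ => Finset.sum_nonneg fun _ _ => sq_nonneg _) (Finset.mem_univ i)

lemma sum_col_sq_le (A : Matrix (Fin m) (Fin n) ℝ) (j : Fin n) :
    ∑ i, A i j ^ 2 ≤ frobNorm A ^ 2 := by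
  rw [frobNorm_sq, Finset.sum_comm]
  exact Finset.single_le_sum (f := fun j => ∑ i, A i j ^ 2)
    (fun _ _ => Finset.sum_nonneg fun _ _ => sq_nonneg _) (Finset.mem_univ j)

end Frobenius

/-! ### Spectral norm acting on orthonormal frames. -/

section SpectralNorm

lemma specNorm_nonneg (G : Matrix (Fin p) (Fin p) ℝ) : 0 ≤ specNorm G := norm_nonneg _

lemma specNorm_transpose (G : Matrix (Fin p) (Fin p) ℝ) : specNorm Gᵀ = specNorm G := by
  have h : Gᵀ = star G := by
    rw [Matrix.star_eq_conjTranspose, Matrix.conjTranspose_eq_transpose_of_trivial]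
  rw [specNorm, h, map_star, ContinuousLinearMap.star_eq_adjoint, LinearIsometryEquiv.norm_map,
    specNorm]

lemma sum_mulVec_sq_le (G : Matrix (Fin p) (Fin p) ℝ) (v : Fin p → ℝ) :
    ∑ i, (G *ᵥ v) i ^ 2 ≤ specNorm G ^ 2 * ∑ i, v i ^ 2 := by
  have h := (Matrix.toEuclideanCLM (n := Fin p) (𝕜 := ℝ) G).le_opNorm (WithLp.toLp 2 v)
  have h2 := pow_le_pow_left₀ (norm_nonneg _) h 2
  rw [mul_pow, EuclideanSpace.norm_sq_eq, EuclideanSpace.norm_sq_eq] at h2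
  simpa [Matrix.ofLp_toEuclideanCLM, specNorm] using h2

lemma frobNorm_mul_sq_le (G : Matrix (Fin p) (Fin p) ℝ) (V : Matrix (Fin p) (Fin r) ℝ) :
    frobNorm (G * V) ^ 2 ≤ specNorm G ^ 2 * frobNorm V ^ 2 := by
  rw [frobNorm_sq, frobNorm_sq, Finset.sum_comm, Finset.sum_comm (f := fun i j => V i j ^ 2),
    Finset.mul_sum]
  refine Finset.sum_le_sum fun j _ => ?_
  have h := sum_mulVec_sq_le G (fun i => V i j)
  simpa [Matrix.mul_apply, Matrix.mulVec, dotProduct] using h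

lemma frobNorm_sq_of_orthonormal {U : Matrix (Fin p) (Fin r) ℝ} (hU : Uᵀ * U = 1) :
    frobNorm U ^ 2 = r := by
  rw [frobNorm_sq_eq_trace, hU, Matrix.trace_one, Fintype.card_fin]

lemma frobNorm_mul_le_of_orthonormal (G : Matrix (Fin p) (Fin p) ℝ)
    {V : Matrix (Fin p) (Fin r) ℝ} (hV : Vᵀ * V = 1) :
    frobNorm (G * V) ≤ specNorm G * Real.sqrt r := by
  refine abs_le_of_sq_le_sq' ?_ (mul_nonneg (specNorm_nonneg _) (Real.sqrt_nonneg _)) |>.2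
  rw [mul_pow, Real.sq_sqrt (Nat.cast_nonneg _), ← frobNorm_sq_of_orthonormal hV]
  exact frobNorm_mul_sq_le G V

end SpectralNorm

/-! ### Nuclear norm, Frobenius norm and rank. -/

section NuclearNorm

lemma nuclearNorm_nonneg (A : Matrix (Fin p) (Fin p) ℝ) : 0 ≤ nuclearNorm A :=
  Finset.sum_nonneg fun _ _ => LinearMap.singularValues_nonneg _ _

lemma toEuclideanLin_eq_toLin_basisFun (A : Matrix (Fin p) (Fin p) ℝ) :
    Matrix.toEuclideanLin A =
      Matrix.toLin (PiLp.basisFun 2 ℝ (Fin p)) (PiLp.basisFun 2 ℝ (Fin p)) A :=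
  DFunLike.congr_fun (Matrix.toLpLin_eq_toLin 2 2) A

lemma sum_singularValues_sq (A : Matrix (Fin p) (Fin p) ℝ) :
    ∑ i ∈ Finset.range p, (Matrix.toEuclideanLin A).singularValues i ^ 2 = frobNorm A ^ 2 := by
  have hn : Module.finrank ℝ (EuclideanSpace ℝ (Fin p)) = p := by simp
  set T := Matrix.toEuclideanLin A with hT
  rw [Finset.sum_range]
  simp only [LinearMap.sq_singularValues_fin T hn]
  have h := T.isSymmetric_adjoint_comp_self.trace_eq_sum_eigenvalues hn
  have h2 : LinearMap.adjoint T ∘ₗ T = Matrix.toEuclideanLin (Aᵀ * A) := by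
    rw [hT, ← Matrix.toEuclideanLin_conjTranspose_eq_adjoint,
      Matrix.conjTranspose_eq_transpose_of_trivial]
    ext x : 1
    simp [Matrix.toLpLin_apply, Matrix.mulVec_mulVec]
  have h3 : LinearMap.trace ℝ _ (LinearMap.adjoint T ∘ₗ T) = (Aᵀ * A).trace := by
    rw [h2, toEuclideanLin_eq_toLin_basisFun, Matrix.trace_toLin_eq]
  rw [frobNorm_sq_eq_trace, ← h3, h]
  simp

lemma finrank_range_toEuclideanLin (A : Matrix (Fin p) (Fin p) ℝ) :
    Module.finrank ℝ (Matrix.toEuclideanLin A).range = A.rank := by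
  rw [toEuclideanLin_eq_toLin_basisFun,
    Matrix.rank_eq_finrank_range_toLin A (PiLp.basisFun 2 ℝ (Fin p)) (PiLp.basisFun 2 ℝ (Fin p))]

/-- Singular values with index at least the rank vanish; Cauchy–Schwarz handles the others. -/
lemma nuclearNorm_le_of_rank_le {A : Matrix (Fin p) (Fin p) ℝ} {k : ℕ} (hk : A.rank ≤ k) :
    nuclearNorm A ≤ Real.sqrt k * frobNorm A := by
  refine abs_le_of_sq_le_sq' ?_ (mul_nonneg (Real.sqrt_nonneg _) (frobNorm_nonneg _)) |>.2
  rw [mul_pow, Real.sq_sqrt (Nat.cast_nonneg _), ← sum_singularValues_sq, nuclearNorm]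
  set T := Matrix.toEuclideanLin A with hT
  have hsub : (Finset.range p).filter (fun i => i < k) ⊆ Finset.range p := Finset.filter_subset _ _
  have hz : ∀ i ∈ Finset.range p, i ∉ (Finset.range p).filter (fun i => i < k) →
      T.singularValues i = 0 := by
    intro i hi hik
    rw [LinearMap.singularValues_eq_zero_iff_le_finrank_range, finrank_range_toEuclideanLin]
    simp only [Finset.mem_filter, hi, true_and, not_lt] at hik
    exact hk.trans hik
  rw [← Finset.sum_subset hsub hz]
  have hcard : (((Finset.range p).filter (fun i => i < k)).card : ℝ) ≤ k := by
    refine Nat.cast_le.2 <|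
      (Finset.card_le_card (t := Finset.range k) ?_).trans_eq (Finset.card_range k)
    intro i hi
    simpa using (Finset.mem_filter.1 hi).2
  refine sq_sum_le_card_mul_sum_sq.trans
    (mul_le_mul hcard ?_ (Finset.sum_nonneg fun _ _ => sq_nonneg _) (Nat.cast_nonneg _))
  exact Finset.sum_le_sum_of_subset_of_nonneg hsub fun _ _ _ => sq_nonneg _

end NuclearNorm

/-! ### Entrywise norms and sparsity. -/

section SparseMatrices

lemma l1Norm_nonneg (A : Matrix (Fin m) (Fin n) ℝ) : 0 ≤ l1Norm A :=
  Finset.sum_nonneg fun _ _ => Finset.sum_nonneg fun _ _ => abs_nonneg _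

lemma l0Norm_sub_le (A B : Matrix (Fin m) (Fin n) ℝ) :
    l0Norm (A - B) ≤ l0Norm A + l0Norm B := by
  refine (Set.ncard_le_ncard ?_ (Set.toFinite _)).trans (Set.ncard_union_le _ _)
  intro x hx
  by_contra h
  simp only [Set.mem_union, Set.mem_ofPred_eq, not_or, not_not] at h hx
  simp [h.1, h.2] at hx

lemma l1Norm_le_of_l0Norm_le {A : Matrix (Fin m) (Fin n) ℝ} {k : ℕ} (hk : l0Norm A ≤ k) :
    l1Norm A ≤ Real.sqrt k * frobNorm A := by
  classical
  refine abs_le_of_sq_le_sq' ?_ (mul_nonneg (Real.sqrt_nonneg _) (frobNorm_nonneg _)) |>.2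
  rw [mul_pow, Real.sq_sqrt (Nat.cast_nonneg _), frobNorm_sq, l1Norm]
  simp only [← Fintype.sum_prod_type (f := fun x : Fin m × Fin n => |A x.1 x.2|),
    ← Fintype.sum_prod_type (f := fun x : Fin m × Fin n => A x.1 x.2 ^ 2)]
  set s := Finset.univ.filter (fun x : Fin m × Fin n => A x.1 x.2 ≠ 0) with hs
  have hcard : (s.card : ℝ) ≤ k := by
    rw [l0Norm, Set.ncard_eq_toFinset_card'] at hk
    refine Nat.cast_le.2 (le_trans (le_of_eq ?_) hk)
    congr 1
    ext x
    simp [hs]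
  rw [← Finset.sum_subset (Finset.subset_univ s) (f := fun x => |A x.1 x.2|)
    (fun x _ hx => by simpa [hs] using hx)]
  refine sq_sum_le_card_mul_sum_sq.trans
    (mul_le_mul hcard ?_ (Finset.sum_nonneg fun _ _ => sq_nonneg _) (Nat.cast_nonneg _))
  simp only [sq_abs]
  exact Finset.sum_le_sum_of_subset_of_nonneg (Finset.subset_univ s) fun _ _ _ => sq_nonneg _

lemma abs_trace_mul_transpose_le_of_entry_le {A B : Matrix (Fin m) (Fin n) ℝ} {M : ℝ}
    (hA : ∀ i j, |A i j| ≤ M) : |(A * Bᵀ).trace| ≤ M * l1Norm B := by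
  rw [trace_mul_transpose, l1Norm, Finset.mul_sum]
  refine (Finset.abs_sum_le_sum_abs _ _).trans (Finset.sum_le_sum fun i _ => ?_)
  rw [Finset.mul_sum]
  refine (Finset.abs_sum_le_sum_abs _ _).trans (Finset.sum_le_sum fun j _ => ?_)
  rw [abs_mul]
  exact mul_le_mul_of_nonneg_right (hA i j) (abs_nonneg _)

lemma abs_entry_le_maxNorm (A : Matrix (Fin m) (Fin n) ℝ) (i : Fin m) (j : Fin n) :
    |A i j| ≤ maxNorm A :=
  le_ciSup (f := fun ij : Fin m × Fin n => |A ij.1 ij.2|) (Set.finite_range _).bddAbove (i, j)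

lemma maxNorm_nonneg (A : Matrix (Fin m) (Fin n) ℝ) : 0 ≤ maxNorm A :=
  Real.iSup_nonneg fun _ => abs_nonneg _

end SparseMatrices

/-! ### The infimal-convolution regularizer. -/

section Regularizer

lemma regularizer_nonneg {lam : ℝ} (hlam : 0 ≤ lam) (Δ : Matrix (Fin p) (Fin p) ℝ) :
    0 ≤ regularizer lam Δ := by
  refine Real.sInf_nonneg ?_
  rintro x ⟨L, S, -, rfl⟩
  exact add_nonneg (nuclearNorm_nonneg L) (mul_nonneg hlam (l1Norm_nonneg S))

lemma regularizer_add_le {lam : ℝ} (hlam : 0 ≤ lam) (L S : Matrix (Fin p) (Fin p) ℝ) :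
    regularizer lam (L + S) ≤ nuclearNorm L + lam * l1Norm S := by
  refine csInf_le ⟨0, ?_⟩ ⟨L, S, rfl, rfl⟩
  rintro x ⟨L, S, -, rfl⟩
  exact add_nonneg (nuclearNorm_nonneg L) (mul_nonneg hlam (l1Norm_nonneg S))

end Regularizer

lemma matrix_rank_add_le (A B : Matrix (Fin m) (Fin n) ℝ) : (A + B).rank ≤ A.rank + B.rank := by
  rw [Matrix.rank, Matrix.mulVecLin_add]
  exact (Submodule.finrank_mono (LinearMap.range_add_le _ _)).trans
    (Submodule.finrank_add_le_finrank_add_finrank _ _)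

/-! ### Differences of two factored matrices. -/

section DifferenceOfLowRank

variable {U₁ U₂ V₁ V₂ : Matrix (Fin p) (Fin r) ℝ}

/-- A difference of two matrices of rank `r`, written as an orthogonal sum of a matrix with columns
in the column space of the first and a matrix with rows in the row space of the second. -/
lemma exists_orthogonal_splitting (hU : U₁ᵀ * U₁ = 1) (hV : V₂ᵀ * V₂ = 1)
    (M₁ M₂ : Matrix (Fin r) (Fin r) ℝ) :
    ∃ (A : Matrix (Fin r) (Fin p) ℝ) (B : Matrix (Fin p) (Fin r) ℝ),
      U₁ * M₁ * V₁ᵀ - U₂ * M₂ * V₂ᵀ = U₁ * A + B * V₂ᵀ ∧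
      frobNorm A ^ 2 + frobNorm B ^ 2 = frobNorm (U₁ * M₁ * V₁ᵀ - U₂ * M₂ * V₂ᵀ) ^ 2 := by
  -- With P = U₁U₁ᵀ, the P-part of the difference is U₁A. The complement 1 − P kills the first
  -- matrix, so what remains factors through V₂ᵀ.
  set A := U₁ᵀ * (U₁ * M₁ * V₁ᵀ - U₂ * M₂ * V₂ᵀ) with hA
  set B := U₁ * (U₁ᵀ * (U₂ * M₂)) - U₂ * M₂ with hB
  have hsum : U₁ * M₁ * V₁ᵀ - U₂ * M₂ * V₂ᵀ = U₁ * A + B * V₂ᵀ := by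
    have h : U₁ᵀ * (U₁ * (M₁ * V₁ᵀ)) = M₁ * V₁ᵀ := by rw [← Matrix.mul_assoc, hU, Matrix.one_mul]
    simp only [hA, hB, Matrix.mul_sub, Matrix.sub_mul, Matrix.mul_assoc, h]
    abel
  have hUB : U₁ᵀ * B = 0 := by
    rw [hB, Matrix.mul_sub, ← Matrix.mul_assoc, hU, Matrix.one_mul, sub_self]
  have hBU : Bᵀ * U₁ = 0 := by
    rw [← Matrix.transpose_transpose U₁, ← Matrix.transpose_mul, hUB, Matrix.transpose_zero]
  refine ⟨A, B, hsum, ?_⟩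
  rw [hsum, frobNorm_sq_eq_trace, frobNorm_sq_eq_trace, frobNorm_sq_eq_trace]
  have e1 : Aᵀ * U₁ᵀ * (U₁ * A) = Aᵀ * A := by
    rw [Matrix.mul_assoc, ← Matrix.mul_assoc U₁ᵀ, hU, Matrix.one_mul]
  have e2 : Aᵀ * U₁ᵀ * (B * V₂ᵀ) = 0 := by
    rw [Matrix.mul_assoc, ← Matrix.mul_assoc U₁ᵀ, hUB, Matrix.zero_mul, Matrix.mul_zero]
  have e3 : V₂ * Bᵀ * (U₁ * A) = 0 := by
    rw [Matrix.mul_assoc, ← Matrix.mul_assoc Bᵀ, hBU, Matrix.zero_mul, Matrix.mul_zero]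
  have e4 : (V₂ * Bᵀ * (B * V₂ᵀ)).trace = (Bᵀ * B).trace := by
    rw [← Matrix.mul_assoc, Matrix.trace_mul_comm, Matrix.mul_assoc V₂, ← Matrix.mul_assoc, hV,
      Matrix.one_mul]
  simp only [Matrix.transpose_add, Matrix.transpose_mul, Matrix.transpose_transpose,
    Matrix.add_mul, Matrix.mul_add, e1, e2, e3, add_zero, zero_add, Matrix.trace_add, e4]

lemma rank_sub_le (hU : U₁ᵀ * U₁ = 1) (hV : V₂ᵀ * V₂ = 1) (M₁ M₂ : Matrix (Fin r) (Fin r) ℝ) :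
    (U₁ * M₁ * V₁ᵀ - U₂ * M₂ * V₂ᵀ).rank ≤ 2 * r := by
  obtain ⟨A, B, h, -⟩ := exists_orthogonal_splitting (V₁ := V₁) (U₂ := U₂) hU hV M₁ M₂
  rw [h, two_mul]
  refine (matrix_rank_add_le _ _).trans (add_le_add ?_ ?_)
  · exact (Matrix.rank_mul_le_left _ _).trans (Matrix.rank_le_width _)
  · exact (Matrix.rank_mul_le_left _ _).trans (Matrix.rank_le_width _)

lemma add_le_sqrt_two_mul_sqrt (a b : ℝ) : a + b ≤ Real.sqrt (2 * (a ^ 2 + b ^ 2)) :=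
  Real.le_sqrt_of_sq_le (by nlinarith [sq_nonneg (a - b)])

/-- Each piece of the splitting pairs with G through a single frame, costing √r; the extra √2 comes
from adding two orthogonal pieces. -/
lemma trace_sub_mul_transpose_le (hU : U₁ᵀ * U₁ = 1) (hV : V₂ᵀ * V₂ = 1)
    (M₁ M₂ : Matrix (Fin r) (Fin r) ℝ) (G : Matrix (Fin p) (Fin p) ℝ) :
    ((U₁ * M₁ * V₁ᵀ - U₂ * M₂ * V₂ᵀ) * Gᵀ).trace ≤
      Real.sqrt (2 * r) * frobNorm (U₁ * M₁ * V₁ᵀ - U₂ * M₂ * V₂ᵀ) * specNorm G := by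
  obtain ⟨A, B, h, hAB⟩ := exists_orthogonal_splitting (V₁ := V₁) (U₂ := U₂) hU hV M₁ M₂
  have hD := frobNorm_nonneg (U₁ * M₁ * V₁ᵀ - U₂ * M₂ * V₂ᵀ)
  have h1 : ((U₁ * M₁ * V₁ᵀ - U₂ * M₂ * V₂ᵀ) * Gᵀ).trace =
      ((Gᵀ * U₁) * (Aᵀ)ᵀ).trace + (B * (G * V₂)ᵀ).trace := by
    rw [h, Matrix.add_mul, Matrix.trace_add, Matrix.transpose_transpose, Matrix.transpose_mul,
      Matrix.mul_assoc B, Matrix.trace_mul_comm (U₁ * A), Matrix.mul_assoc]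
  have hAt : frobNorm Aᵀ = frobNorm A := by
    rw [frobNorm, Finset.sum_comm]
    rfl
  have h2 := trace_mul_transpose_le (Gᵀ * U₁) Aᵀ
  have h3 := trace_mul_transpose_le B (G * V₂)
  have h4 := frobNorm_mul_le_of_orthonormal Gᵀ hU
  have h5 := frobNorm_mul_le_of_orthonormal G hV
  rw [specNorm_transpose] at h4
  rw [hAt] at h2
  have h6 := mul_le_mul_of_nonneg_right h4 (frobNorm_nonneg A)
  have h7 := mul_le_mul_of_nonneg_left h5 (frobNorm_nonneg B)
  have h8 := add_le_sqrt_two_mul_sqrt (frobNorm A) (frobNorm B)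
  rw [hAB, Real.sqrt_mul zero_le_two, Real.sqrt_sq hD] at h8
  have h9 := mul_le_mul_of_nonneg_left h8
    (mul_nonneg (specNorm_nonneg G) (Real.sqrt_nonneg (r : ℝ)))
  rw [h1, Real.sqrt_mul zero_le_two]
  nlinarith

lemma abs_sum_mul_le_of_sq_le {a b : Fin n → ℝ} {ρ D : ℝ} (hD : 0 ≤ D)
    (ha : ∑ k, a k ^ 2 ≤ ρ) (hb : ∑ k, b k ^ 2 ≤ D ^ 2) : |∑ k, a k * b k| ≤ Real.sqrt ρ * D := by
  have hρ : 0 ≤ ρ := (Finset.sum_nonneg fun _ _ => sq_nonneg _).trans ha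
  refine abs_le_of_sq_le_sq ?_ (mul_nonneg (Real.sqrt_nonneg _) hD)
  rw [mul_pow, Real.sq_sqrt hρ]
  exact (Finset.sum_mul_sq_le_sq_mul_sq _ _ _).trans
    (mul_le_mul ha hb (Finset.sum_nonneg fun _ _ => sq_nonneg _) hρ)

/-- Cauchy–Schwarz on each piece of the splitting: a row of U₁ against a column of A, and a row of
V₂ against a row of B. Hence no incoherence of U₂ or V₁, and no dependence on the size of M₁, M₂. -/
lemma abs_sub_entry_le (hU : U₁ᵀ * U₁ = 1) (hV : V₂ᵀ * V₂ = 1) {ρ : ℝ}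
    (hU' : ∀ i, ∑ k, U₁ i k ^ 2 ≤ ρ) (hV' : ∀ i, ∑ k, V₂ i k ^ 2 ≤ ρ)
    (M₁ M₂ : Matrix (Fin r) (Fin r) ℝ) (i j : Fin p) :
    |(U₁ * M₁ * V₁ᵀ - U₂ * M₂ * V₂ᵀ) i j| ≤
      2 * Real.sqrt ρ * frobNorm (U₁ * M₁ * V₁ᵀ - U₂ * M₂ * V₂ᵀ) := by
  obtain ⟨A, B, h, hAB⟩ := exists_orthogonal_splitting (V₁ := V₁) (U₂ := U₂) hU hV M₁ M₂
  set D := U₁ * M₁ * V₁ᵀ - U₂ * M₂ * V₂ᵀ with hDdef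
  have hA := sum_col_sq_le A j
  have hB := sum_row_sq_le B i
  have h1 : D i j = (∑ k, U₁ i k * A k j) + ∑ k, V₂ j k * B i k := by
    rw [h]
    simp [Matrix.mul_apply, mul_comm]
  have h2 := abs_sum_mul_le_of_sq_le (frobNorm_nonneg D) (hU' i)
    (hA.trans (by nlinarith [sq_nonneg (frobNorm B)]))
  have h3 := abs_sum_mul_le_of_sq_le (frobNorm_nonneg D) (hV' j)
    (hB.trans (by nlinarith [sq_nonneg (frobNorm A)]))
  rw [h1]
  refine (abs_add_le _ _).trans ?_
  linarith

end DifferenceOfLowRank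

/-! ### Extending incoherent frames by flat vectors. -/

section IncoherentExtension

/-- Every subspace of `ℝ^n` of dimension at least `d` contains a vector in the unit cube with
squared Euclidean norm at least `d`. -/
lemma exists_mem_abs_le_one_le_sum_sq (H : Submodule ℝ (Fin n → ℝ)) {d : ℕ}
    (hd : d ≤ Module.finrank ℝ H) :
    ∃ u ∈ H, (∀ i, |u i| ≤ 1) ∧ (d : ℝ) ≤ ∑ i, u i ^ 2 := by
  classical
  set K : Set (Fin n → ℝ) := (H : Set (Fin n → ℝ)) ∩ Metric.closedBall 0 1 with hK
  have hKc : IsCompact K := (isCompact_closedBall 0 1).inter_left H.closed_of_finiteDimensional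
  have hmem : ∀ u, u ∈ K ↔ u ∈ H ∧ ∀ i, |u i| ≤ 1 := by
    intro u
    simp [hK, pi_norm_le_iff_of_nonneg zero_le_one]
  obtain ⟨u, huK, hmax⟩ := hKc.exists_isMaxOn ⟨0, (hmem 0).2 ⟨H.zero_mem, by simp⟩⟩
    (f := fun u => ∑ i, u i ^ 2) (by fun_prop)
  obtain ⟨huH, hu⟩ := (hmem u).1 huK
  refine ⟨u, huH, hu, ?_⟩
  -- Active cube constraints at the maximizer. With fewer than d of them, some nonzero h in `H`
  -- vanishes on `T`, and u ± εh both stay in the cube.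
  set T := Finset.univ.filter (fun i => |u i| = 1) with hT
  have hdT : d ≤ T.card := by
    by_contra! hlt
    -- restriction of the elements of `H` to the coordinates in `T` has a nontrivial kernel
    let f : H →ₗ[ℝ] (T → ℝ) := (LinearMap.funLeft ℝ ℝ (Subtype.val : T → Fin n)) ∘ₗ H.subtype
    have hker : LinearMap.ker f ≠ ⊥ := by
      refine LinearMap.ker_ne_bot_of_finrank_lt ?_
      rw [Module.finrank_fintype_fun_eq_card, Fintype.card_coe]
      omega
    obtain ⟨⟨h, hH⟩, hf, hne⟩ := Submodule.exists_mem_ne_zero_of_ne_bot hker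
    have hT0 : ∀ i ∈ T, h i = 0 := fun i hi => congrFun (LinearMap.mem_ker.1 hf) ⟨i, hi⟩
    have hpos : 0 < ∑ i, h i ^ 2 := by
      obtain ⟨i, hi⟩ : ∃ i, h i ≠ 0 := by
        by_contra! h0
        exact hne (Subtype.ext (funext h0))
      exact Finset.sum_pos' (fun _ _ => sq_nonneg _) ⟨i, Finset.mem_univ i, by positivity⟩
    have hev : ∀ᶠ ε in nhdsWithin (0 : ℝ) {0}ᶜ, ∀ i, |u i + ε * h i| ≤ 1 ∧ |u i - ε * h i| ≤ 1 := by
      refine nhdsWithin_le_nhds (Filter.eventually_all.2 fun i => ?_)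
      by_cases hi : i ∈ T
      · simp [hT0 i hi, hu i]
      · have hlt : |u i| < 1 := lt_of_le_of_ne (hu i) (by simpa [hT] using hi)
        have c1 : Filter.Tendsto (fun ε : ℝ => |u i + ε * h i|) (nhds 0) (nhds |u i|) :=
          Continuous.tendsto' (by fun_prop) _ _ (by simp)
        have c2 : Filter.Tendsto (fun ε : ℝ => |u i - ε * h i|) (nhds 0) (nhds |u i|) :=
          Continuous.tendsto' (by fun_prop) _ _ (by simp)
        filter_upwards [c1.eventually_lt_const hlt, c2.eventually_lt_const hlt] with ε h1 h2
        exact ⟨h1.le, h2.le⟩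
    obtain ⟨ε, hε, hε0⟩ := (hev.and self_mem_nhdsWithin).exists
    have hε0 : ε ≠ 0 := hε0
    have m1 := hmax ((hmem (u + ε • h)).2 ⟨H.add_mem huH (H.smul_mem ε hH), fun i => (hε i).1⟩)
    have m2 := hmax ((hmem (u - ε • h)).2 ⟨H.sub_mem huH (H.smul_mem ε hH), fun i => (hε i).2⟩)
    -- Parallelogram law: one of u ± εh is strictly longer than u, contradicting maximality.
    have hsum : ∑ i, (u + ε • h) i ^ 2 + ∑ i, (u - ε • h) i ^ 2 =
        2 * ∑ i, u i ^ 2 + 2 * ε ^ 2 * ∑ i, h i ^ 2 := by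
      rw [← Finset.sum_add_distrib, Finset.mul_sum, Finset.mul_sum, ← Finset.sum_add_distrib]
      refine Finset.sum_congr rfl fun i _ => ?_
      simp only [Pi.add_apply, Pi.sub_apply, Pi.smul_apply, smul_eq_mul]
      ring
    have : 0 < ε ^ 2 * ∑ i, h i ^ 2 := by positivity
    simp only [Set.mem_ofPred_eq] at m1 m2
    linarith
  calc (d : ℝ) ≤ T.card := by exact_mod_cast hdT
    _ = ∑ i ∈ T, u i ^ 2 := by
      rw [Finset.cast_card]
      refine Finset.sum_congr rfl fun i hi => ?_
      rw [← sq_abs, (Finset.mem_filter.1 hi).2, one_pow]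
    _ ≤ ∑ i, u i ^ 2 :=
      Finset.sum_le_sum_of_subset_of_nonneg (Finset.subset_univ T) fun _ _ _ => sq_nonneg _

/-- A matrix with `k < p` columns has a unit vector orthogonal to its columns with squared entries
at most `1 / (p - k)`. -/
lemma exists_flat_unit_vector {k : ℕ} (hk : k < p) (U : Matrix (Fin p) (Fin k) ℝ) :
    ∃ u : Fin p → ℝ, (∀ a, ∑ i, U i a * u i = 0) ∧ ∑ i, u i ^ 2 = 1 ∧
      ∀ i, u i ^ 2 ≤ 1 / ((p : ℝ) - k) := by
  have hpk : (0 : ℝ) < (p : ℝ) - k := sub_pos.2 (Nat.cast_lt.2 hk)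
  have hd : p - k ≤ Module.finrank ℝ (LinearMap.ker Uᵀ.mulVecLin) := by
    have h := LinearMap.finrank_range_add_finrank_ker Uᵀ.mulVecLin
    have h2 := Submodule.finrank_le (LinearMap.range Uᵀ.mulVecLin)
    simp only [Module.finrank_fintype_fun_eq_card, Fintype.card_fin] at h h2
    omega
  obtain ⟨v, hvH, hv1, hv⟩ := exists_mem_abs_le_one_le_sum_sq _ hd
  rw [Nat.cast_sub hk.le] at hv
  set s := ∑ i, v i ^ 2 with hs
  have hs0 : 0 < s := hpk.trans_le hv
  have hsq : Real.sqrt s ^ 2 = s := Real.sq_sqrt hs0.le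
  refine ⟨fun i => v i / Real.sqrt s, fun a => ?_, ?_, fun i => ?_⟩
  · have h0 : ∑ i, U i a * v i = 0 := congrFun (LinearMap.mem_ker.1 hvH) a
    simp only [← mul_div_assoc, ← Finset.sum_div, h0, zero_div]
  · simp only [div_pow, hsq, ← Finset.sum_div]
    exact div_self hs0.ne'
  · rw [div_pow, hsq]
    exact div_le_div₀ zero_le_one ((sq_le_one_iff_abs_le_one _).2 (hv1 i)) hpk hv

lemma exists_orthonormal_snoc {k : ℕ} (hk : k < p) {U : Matrix (Fin p) (Fin k) ℝ}
    (hU : Uᵀ * U = 1) :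
    ∃ U' : Matrix (Fin p) (Fin (k + 1)) ℝ, U'ᵀ * U' = 1 ∧ (∀ i a, U' i (Fin.castSucc a) = U i a) ∧
      ∀ i, ∑ a, U' i a ^ 2 ≤ (∑ a, U i a ^ 2) + 1 / ((p : ℝ) - k) := by
  obtain ⟨u, hu0, hu1, hu⟩ := exists_flat_unit_vector hk U
  refine ⟨Matrix.of fun i => Fin.snoc (U i) (u i), ?_, fun i a => by simp, fun i => ?_⟩
  · have hU' : ∀ a b, ∑ i, U i a * U i b = (1 : Matrix (Fin k) (Fin k) ℝ) a b := by
      intro a b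
      rw [← hU, Matrix.mul_apply]
      rfl
    ext a b
    rw [Matrix.mul_apply]
    refine Fin.lastCases ?_ (fun a => ?_) a <;> refine Fin.lastCases ?_ (fun b => ?_) b
    · simpa [sq] using hu1
    · simpa [Matrix.one_apply, mul_comm, Fin.ext_iff, (Fin.is_lt b).ne'] using hu0 b
    · simpa [Matrix.one_apply, Fin.ext_iff, (Fin.is_lt a).ne] using hu0 a
    · simpa [Matrix.one_apply] using hU' a b
  · rw [Fin.sum_univ_castSucc]
    simpa using hu i

lemma diagonal_factorization_apply {k : ℕ} (U V : Matrix (Fin p) (Fin k) ℝ) (σ : Fin k → ℝ)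
    (i j : Fin p) : (U * Matrix.diagonal σ * Vᵀ) i j = ∑ a, U i a * σ a * V j a := by
  rw [Matrix.mul_apply]
  simp [Matrix.mul_diagonal]

/-- Factorizations with orthonormal frames can be padded to a larger number `k` of columns while
keeping the frames incoherent. -/
lemma exists_padded_factorization {L : Matrix (Fin p) (Fin p) ℝ} {r₀ k R : ℕ} {ν : ℝ}
    (hk : r₀ ≤ k) (hkR : k ≤ R) (hR : R ≤ p)
    (hν : r₀ < R → (1 : ℝ) / ((p : ℝ) - R + 1) ≤ ν)
    {U V : Matrix (Fin p) (Fin r₀) ℝ} {σ : Fin r₀ → ℝ}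
    (hL : L = U * Matrix.diagonal σ * Vᵀ) (hU : Uᵀ * U = 1) (hV : Vᵀ * V = 1)
    (hU' : ∀ i, ∑ a, U i a ^ 2 ≤ r₀ * ν) (hV' : ∀ i, ∑ a, V i a ^ 2 ≤ r₀ * ν) :
    ∃ (U' V' : Matrix (Fin p) (Fin k) ℝ) (σ' : Fin k → ℝ),
      L = U' * Matrix.diagonal σ' * V'ᵀ ∧ U'ᵀ * U' = 1 ∧ V'ᵀ * V' = 1 ∧
      (∀ i, ∑ a, U' i a ^ 2 ≤ k * ν) ∧ ∀ i, ∑ a, V' i a ^ 2 ≤ k * ν := by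
  induction k, hk using Nat.le_induction with
  | base => exact ⟨U, V, σ, hL, hU, hV, hU', hV'⟩
  | succ k hk ih =>
    obtain ⟨U₁, V₁, σ₁, hL₁, hU₁, hV₁, hU₁', hV₁'⟩ := ih (by omega)
    obtain ⟨U₂, hU₂, hUU, hU₂'⟩ := exists_orthonormal_snoc (by omega) hU₁
    obtain ⟨V₂, hV₂, hVV, hV₂'⟩ := exists_orthonormal_snoc (by omega) hV₁
    have hR' : (R : ℝ) ≤ p := Nat.cast_le.2 hR
    have hkR' : (k : ℝ) + 1 ≤ R := by exact_mod_cast hkR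
    -- Since k + 1 ≤ R, the denominator is at least p − R + 1, so each new column uses exactly its
    -- allowance ν at most.
    have hstep : 1 / ((p : ℝ) - k) ≤ ν :=
      (one_div_le_one_div_of_le (by linarith) (by linarith)).trans (hν (by omega))
    refine ⟨U₂, V₂, Fin.snoc σ₁ 0, ?_, hU₂, hV₂, fun i => ?_, fun i => ?_⟩
    · rw [hL₁]
      ext i j
      rw [diagonal_factorization_apply, diagonal_factorization_apply, Fin.sum_univ_castSucc]
      simp [hUU, hVV]
    · push_cast
      linarith [hU₂' i, hU₁' i]
    · push_cast
      linarith [hV₂' i, hV₁' i]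

end IncoherentExtension

/-! ### Feasibility of the truth and the error estimates. -/

section Estimator

lemma sum_row_sq_le_of_mem {U : Matrix (Fin p) (Fin r) ℝ} {μ ν : ℝ}
    (hU : U ∈ IncoherentFrames p r μ) (hμν : μ ≤ ν) (hν : 0 ≤ ν) (i : Fin p) :
    ∑ a, U i a ^ 2 ≤ r * (ν / p) := by
  have h : Real.sqrt (∑ a, U i a ^ 2) ≤ twoInfNorm U :=
    le_ciSup (f := fun i => Real.sqrt (∑ a, U i a ^ 2)) (Set.finite_range _).bddAbove i
  have h2 : Real.sqrt (μ * r / p) ≤ Real.sqrt (r * (ν / p)) := by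
    refine Real.sqrt_le_sqrt ?_
    rw [mul_comm, mul_div_assoc]
    gcongr
  exact (Real.sqrt_le_sqrt_iff (by positivity)).1 (h.trans (hU.2.trans h2))

/-- `max μ 0` matches `Real.sqrt`, which is 0 on negative arguments. -/
lemma mem_incoherentFrames {U : Matrix (Fin p) (Fin r) ℝ} {μ : ℝ} (hU : Uᵀ * U = 1)
    (h : ∀ i, ∑ a, U i a ^ 2 ≤ r * (max μ 0 / p)) : U ∈ IncoherentFrames p r μ := by
  refine ⟨hU, Real.iSup_le (fun i => ?_) (Real.sqrt_nonneg _)⟩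
  rcases le_total 0 μ with hμ | hμ
  · refine Real.sqrt_le_sqrt ((h i).trans_eq ?_)
    rw [max_eq_left hμ]
    ring
  · have h0 := h i
    rw [max_eq_right hμ, zero_div, mul_zero] at h0
    rw [Real.sqrt_eq_zero_of_nonpos h0]
    exact Real.sqrt_nonneg _

/-- An incoherent singular value decomposition can be padded to a factorization that is feasible
for the over-specified rank. -/
lemma HasIncoherentSVD.exists_padded {L : Matrix (Fin p) (Fin p) ℝ} {R : ℕ} {μ ν : ℝ}
    (hL : HasIncoherentSVD L r μ) (hrR : r ≤ R) (hRp : R ≤ p) (hμν : μ ≤ ν)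
    (hν : r < R → (p : ℝ) ≤ ν * ((p : ℝ) - R + 1)) :
    ∃ U ∈ IncoherentFrames p R ν, ∃ V ∈ IncoherentFrames p R ν, ∃ σ : Fin R → ℝ,
      L = U * Matrix.diagonal σ * Vᵀ := by
  obtain ⟨U, hU, V, hV, σ, -, hL⟩ := hL
  have hν' : r < R → (1 : ℝ) / ((p : ℝ) - R + 1) ≤ max ν 0 / p := by
    intro h
    have hp : (0 : ℝ) < p := Nat.cast_pos.2 (by omega)
    have hR : (R : ℝ) ≤ p := Nat.cast_le.2 hRp
    have hpR : (0 : ℝ) < (p : ℝ) - R + 1 := by linarith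
    rw [div_le_div_iff₀ hpR hp, one_mul]
    exact (hν h).trans (mul_le_mul_of_nonneg_right (le_max_left _ _) hpR.le)
  obtain ⟨U', V', σ', hL', hU', hV', hUr, hVr⟩ :=
    exists_padded_factorization hrR le_rfl hRp hν' hL hU.1 hV.1
      (sum_row_sq_le_of_mem hU (hμν.trans (le_max_left _ _)) (le_max_right _ _))
      (sum_row_sq_le_of_mem hV (hμν.trans (le_max_left _ _)) (le_max_right _ _))
  exact ⟨U', mem_incoherentFrames hU' hUr, V', mem_incoherentFrames hV' hVr, σ', hL'⟩

lemma le_of_transpose_mul_self_eq_one {U : Matrix (Fin p) (Fin r) ℝ} (hU : Uᵀ * U = 1) :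
    r ≤ p := by
  have h := Matrix.rank_mul_le_right Uᵀ U
  rw [hU, Matrix.rank_one, Fintype.card_fin] at h
  exact h.trans (Matrix.rank_le_height U)

/-- Squaring asks for 8Rμs/p ≤ 1/16, whence 128. The fourth power enters only through R ≤ R⁴. -/
lemma incoherence_constant_le {R s : ℕ} {μ : ℝ} (h : 128 * μ * (R : ℝ) ^ 4 * s ≤ p) :
    2 * Real.sqrt (R * (max μ 0 / p)) * Real.sqrt (2 * s) ≤ 1 / 4 := by
  have hp : (0 : ℝ) ≤ p := Nat.cast_nonneg _
  have hRR : (R : ℝ) ≤ (R : ℝ) ^ 4 := by exact_mod_cast Nat.le_self_pow (by norm_num) R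
  have h1 : 128 * max μ 0 * R * s ≤ p := by
    rcases le_total 0 μ with hμ | hμ
    · rw [max_eq_left hμ]
      refine le_trans ?_ h
      gcongr
    · rw [max_eq_right hμ]
      simp
  have h2 : 128 * (R * (max μ 0 / p) * s) ≤ 1 := by
    rw [show 128 * (R * (max μ 0 / p) * s) = (128 * max μ 0 * R * s) / p by ring]
    exact div_le_one_of_le₀ h1 hp
  rw [mul_assoc, ← Real.sqrt_mul (by positivity)]
  have h3 : Real.sqrt (R * (max μ 0 / p) * (2 * s)) ≤ 1 / 8 := by
    rw [Real.sqrt_le_left (by norm_num)]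
    linarith
  linarith

/-- The basic inequality for a least-squares solution. -/
lemma half_norm_sq_le_inner {E : Type*} [NormedAddCommGroup E] [InnerProductSpace ℝ E] {y w : E}
    (h : 1 / 2 * ‖w - y‖ ^ 2 ≤ 1 / 2 * ‖w‖ ^ 2) : 1 / 2 * ‖y‖ ^ 2 ≤ inner ℝ y w := by
  rw [norm_sub_sq_real, real_inner_comm] at h
  linarith

lemma mul_regularizer_sq_le {L S : Matrix (Fin p) (Fin p) ℝ} {R s : ℕ} {lam κ τ : ℝ}
    (hlam : 0 ≤ lam) (hκ : 0 < κ) (hs : 32 * τ * s * max 1 (lam ^ 2) ≤ κ)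
    (hR : 32 * τ * R ≤ κ) (hL : L.rank ≤ 2 * R) (hS : l0Norm S ≤ 2 * s) :
    τ * regularizer lam (L + S) ^ 2 ≤ κ / 8 * (frobNorm L ^ 2 + frobNorm S ^ 2) := by
  rcases le_or_gt τ 0 with hτ | hτ
  · exact (mul_nonpos_of_nonpos_of_nonneg hτ (sq_nonneg _)).trans (by positivity)
  have h1 := nuclearNorm_le_of_rank_le hL
  have h2 := l1Norm_le_of_l0Norm_le hS
  have h3 : regularizer lam (L + S) ≤
      Real.sqrt (2 * R : ℕ) * frobNorm L + lam * (Real.sqrt (2 * s : ℕ) * frobNorm S) :=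
    (regularizer_add_le hlam L S).trans (add_le_add h1 (mul_le_mul_of_nonneg_left h2 hlam))
  have h4 := pow_le_pow_left₀ (regularizer_nonneg hlam _) h3 2
  -- The factors 4 are (x+y)² ≤ 2(x²+y²) times the doubled rank and sparsity; 4 · 8 = 32 then leaves
  -- κ/8.
  have h5 : (Real.sqrt (2 * R : ℕ) * frobNorm L +
      lam * (Real.sqrt (2 * s : ℕ) * frobNorm S)) ^ 2 ≤
      4 * R * frobNorm L ^ 2 + 4 * s * lam ^ 2 * frobNorm S ^ 2 := by
    refine add_sq_le.trans_eq ?_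
    simp only [mul_pow, Real.sq_sqrt (Nat.cast_nonneg _)]
    push_cast
    ring
  have h6 : 32 * τ * s * lam ^ 2 ≤ κ :=
    (mul_le_mul_of_nonneg_left (le_max_right _ _) (by positivity)).trans hs
  have h7 := mul_le_mul_of_nonneg_left (h4.trans h5) hτ.le
  have h8 := mul_le_mul_of_nonneg_right h6 (sq_nonneg (frobNorm S))
  have h9 := mul_le_mul_of_nonneg_right hR (sq_nonneg (frobNorm L))
  linarith

/-- If `D` has small entries and `S` is sparse, the Frobenius norm of `D + S` controls both. -/
lemma frobNorm_add_sq_ge {D S : Matrix (Fin p) (Fin p) ℝ} {k : ℕ} {M : ℝ}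
    (hD : ∀ i j, |D i j| ≤ M * frobNorm D) (hS : l0Norm S ≤ k) (hM : 0 ≤ M)
    (hMk : M * Real.sqrt k ≤ 1 / 4) :
    3 / 4 * (frobNorm D ^ 2 + frobNorm S ^ 2) ≤ frobNorm (D + S) ^ 2 := by
  have h1 := (abs_trace_mul_transpose_le_of_entry_le hD (B := S)).trans
    (mul_le_mul_of_nonneg_left (l1Norm_le_of_l0Norm_le hS) (mul_nonneg hM (frobNorm_nonneg D)))
  have h2 := mul_le_mul_of_nonneg_right hMk (mul_nonneg (frobNorm_nonneg D) (frobNorm_nonneg S))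
  have h3 := neg_abs_le (D * Sᵀ).trace
  rw [frobNorm_add_sq]
  nlinarith [sq_nonneg (frobNorm D - frobNorm S)]

/-- Expand (κa − 4x)² + (κb − 4y)² ≥ 0 and insert the hypothesis. -/
lemma add_sq_le_of_mul_le {κ a b x y : ℝ} (hκ : 0 < κ)
    (h : κ / 4 * (a ^ 2 + b ^ 2) ≤ x * a + y * b) :
    a ^ 2 + b ^ 2 ≤ 16 / κ ^ 2 * (x ^ 2 + y ^ 2) := by
  rw [div_mul_eq_mul_div, le_div_iff₀ (by positivity)]
  nlinarith [mul_le_mul_of_nonneg_left h hκ.le, sq_nonneg (κ * a - 4 * x),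
    sq_nonneg (κ * b - 4 * y)]

end Estimator

end LowRankSparse

/-! ### Assembly of the bound. -/

theorem theorem1 :
    ∃ c : ℝ, 0 < c ∧
      ∀ (p r rbar sbar : ℕ) (μ μbar κ τ lam : ℝ)
        (E : Type*) [NormedAddCommGroup E] [InnerProductSpace ℝ E] [FiniteDimensional ℝ E]
        (X : Matrix (Fin p) (Fin p) ℝ →ₗ[ℝ] E) (Y W : E)
        (Lstar Sstar Lhat Shat : Matrix (Fin p) (Fin p) ℝ)
        (Uhat Vhat : Matrix (Fin p) (Fin rbar) ℝ) (σhat : Fin rbar → ℝ),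
        -- the known upper bounds, and the ranges of the parameters
        r ≤ rbar → μ ≤ μbar → 0 < κ → 0 ≤ lam →
        -- `μbar` is not degenerately close to its minimal value 1, in the over-specified case
        (r < rbar → (p : ℝ) ≤ μbar * ((p : ℝ) - rbar + 1)) →
        -- the observation model
        Y = X (Lstar + Sstar) + W →
        -- restricted strong convexity, and the condition on its parameters
        LowRankSparse.RSC X lam κ τ →
        32 * τ * sbar * max 1 (lam ^ 2) ≤ κ →
        32 * τ * rbar ≤ κ →
        -- the structure of the ground truth
        LowRankSparse.HasIncoherentSVD Lstar r μ →
        LowRankSparse.l0Norm Sstar ≤ sbar →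
        8 * c * μbar * (rbar : ℝ) ^ 4 * sbar ≤ p →
        -- the estimator
        LowRankSparse.IsSolution X Y rbar sbar μbar Lhat Shat Uhat Vhat σhat →
        LowRankSparse.frobNorm (Lhat - Lstar) ^ 2 + LowRankSparse.frobNorm (Shat - Sstar) ^ 2 ≤
          128 / κ ^ 2 *
            (rbar * LowRankSparse.specNorm (LowRankSparse.conjOp X W) ^ 2 +
              sbar * LowRankSparse.maxNorm (LowRankSparse.conjOp X W) ^ 2) := by
  -- 8 · 16 = 128, the constant of `incoherence_constant_le`.
  refine ⟨16, by norm_num, ?_⟩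
  intro p r rbar sbar μ μbar κ τ lam E _ _ _ X Y W Lstar Sstar Lhat Shat Uhat Vhat σhat hr hμ hκ
    hlam hμbar hY hRSC hτs hτr hLstar hSstar hc hsol
  obtain ⟨⟨hLhat, hUhat, hVhat, hShat⟩, hopt⟩ := hsol
  -- The truth becomes a competitor; r̄ ≤ p because an orthonormal frame `Uhat` exists.
  obtain ⟨U, hU, V, hV, σ, hL⟩ := hLstar.exists_padded hr
    (LowRankSparse.le_of_transpose_mul_self_eq_one hUhat.1) hμ hμbar
  have hopt := hopt Lstar Sstar U V σ ⟨hL, hU, hV, hSstar⟩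
  have hentry := LowRankSparse.abs_sub_entry_le (V₁ := Vhat) (U₂ := U) hUhat.1 hV.1
    (LowRankSparse.sum_row_sq_le_of_mem hUhat (le_max_left _ _) (le_max_right _ 0))
    (LowRankSparse.sum_row_sq_le_of_mem hV (le_max_left _ _) (le_max_right _ 0))
    (Matrix.diagonal σhat) (Matrix.diagonal σ)
  have hrank := LowRankSparse.rank_sub_le (V₁ := Vhat) (U₂ := U) hUhat.1 hV.1
    (Matrix.diagonal σhat) (Matrix.diagonal σ)
  have htraceL := LowRankSparse.trace_sub_mul_transpose_le (V₁ := Vhat) (U₂ := U) hUhat.1 hV.1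
    (Matrix.diagonal σhat) (Matrix.diagonal σ) (LowRankSparse.conjOp X W)
  rw [← hLhat, ← hL] at hentry hrank htraceL
  have hsparse : LowRankSparse.l0Norm (Shat - Sstar) ≤ 2 * sbar :=
    (LowRankSparse.l0Norm_sub_le _ _).trans (by omega)
  have hbasic := LowRankSparse.half_norm_sq_le_inner
    (y := X ((Lhat - Lstar) + (Shat - Sstar))) (w := W) (by
      have e1 : Y - X (Lhat + Shat) = W - X ((Lhat - Lstar) + (Shat - Sstar)) := by
        rw [hY]
        simp only [map_add, map_sub]
        abel
      have e2 : Y - X (Lstar + Sstar) = W := by rw [hY, add_sub_cancel_left]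
      rwa [e1, e2] at hopt)
  rw [LowRankSparse.inner_eq_trace_conjOp, Matrix.add_mul, Matrix.trace_add] at hbasic
  have htraceS := (le_abs_self _).trans (LowRankSparse.abs_trace_mul_transpose_le_of_entry_le
    (A := LowRankSparse.conjOp X W) (B := Shat - Sstar)
    (LowRankSparse.abs_entry_le_maxNorm _))
  rw [← Matrix.trace_transpose, Matrix.transpose_mul, Matrix.transpose_transpose] at htraceS
  have hl1 := mul_le_mul_of_nonneg_left (LowRankSparse.l1Norm_le_of_l0Norm_le hsparse)
    (LowRankSparse.maxNorm_nonneg (LowRankSparse.conjOp X W))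
  have hreg := LowRankSparse.mul_regularizer_sq_le hlam hκ hτs hτr hrank hsparse
  have hfrob := LowRankSparse.frobNorm_add_sq_ge hentry hsparse (by positivity)
    (by
      push_cast
      exact LowRankSparse.incoherence_constant_le (by linarith))
  have hfrobκ := mul_le_mul_of_nonneg_left hfrob (half_pos hκ).le
  have hconv := hRSC ((Lhat - Lstar) + (Shat - Sstar))
  push_cast at hl1
  -- The coefficient is (κ/2)(3/4) − κ/8 = κ/4. The resulting constant 32/κ² is below the one
  -- claimed.
  refine (LowRankSparse.add_sq_le_of_mul_le hκ
    (x := Real.sqrt (2 * rbar) * LowRankSparse.specNorm (LowRankSparse.conjOp X W))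
    (y := Real.sqrt (2 * sbar) * LowRankSparse.maxNorm (LowRankSparse.conjOp X W))
    (by linarith)).trans ?_
  rw [mul_pow, mul_pow, Real.sq_sqrt (by positivity), Real.sq_sqrt (by positivity),
    div_mul_eq_mul_div, div_mul_eq_mul_div]
  refine div_le_div_of_nonneg_right ?_ (by positivity)
  have h1 : 0 ≤ rbar * LowRankSparse.specNorm (LowRankSparse.conjOp X W) ^ 2 := by positivity
  have h2 : 0 ≤ sbar * LowRankSparse.maxNorm (LowRankSparse.conjOp X W) ^ 2 := by positivity
  linarith
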